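/- A cell of $\mathbb{Z}^2$ is a unit square with vertices in $\mathbb{Z}^2$. For a finite collection $\mathcal{S}$ of cells let $V(\mathcal{S})$ be the set of the vertices of its cells. For $a=(i,j)$ and $b=(k,l)$ in $\mathbb{Z}^2$ with $i<k$ and $j<l$, the interval $[a,b]$ is an inner interval of $\mathcal{S}$ if all cells contained in it belong to $\mathcal{S}$; its anti-diagonal corners are $c=(i,l)$ and $d=(k,j)$. For a field $K$ let $S_{\mathcal{S}}=K[x_v\mid v\in V(\mathcal{S})]$, let $I_{\mathcal{S}}$ be the ideal generated by all binomials $x_ax_b-x_cx_d$, where $[a,b]$ runs over the inner intervals of $\mathcal{S}$, let $K[\mathcal{S}]=S_{\mathcal{S}}/I_{\mathcal{S}}$ with the standard grading, and let $\mathrm{HP}_{K[\mathcal{S}]}(t)=\sum_{k\ge 0}\dim_K(K[\mathcal{S}]_k)\,t^k$. A finite collection of cells $\mathcal{P}$ is a closed path if its cells can be arranged in a sequence $C_1,\dots,C_n$, $n>5$, of distinct cells, indices being read modulo $n$, such that $C_i\cap C_{i+1}$ is a common edge of $C_i$ and $C_{i+1}$ for all $i$, and $V(C_i)\cap V(C_j)=\emptyset$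 whenever $j\notin\{i-2,i-1,i,i+1,i+2\}$. A configuration $\mathcal{W}$ consists of a horizontal block $[A_s,A_1]$ of $s\ge 2$ consecutive cells with rightmost cell $A_1$, a vertical block $[B_1,B_r]$ of $r\ge 2$ consecutive cells with lowest cell $B_1$, and a cell $A\notin[A_s,A_1]\cup[B_1,B_r]$, such that $V([A_s,A_1])\cap V([B_1,B_r])=\{b\}$, where $b$ is at the same time the lower right corner of $A$, the upper right corner of $A_1$ and the lower left corner of $B_1$ (so $A_1$ lies directly below $A$, and $B_1$ directly to the right of $A$). Proposition. Let $K$ be a field and let $\mathcal{P}$ be a closed path containing a configuration $\mathcal{W}$ as above. Put $\mathcal{Q}=\mathcal{P}\setminus\{A\}$ and $\mathcal{Q}_1=\mathcal{P}\setminus\{A,A_1,B_1\}$. Then $$\mathrm{HP}_{K[\mathcal{P}]}(t)=\mathrm{HP}_{K[\mathcal{Q}]}(t)+\frac{t}{1-t}\,\mathrm{HP}_{K[\mathcal{Q}_1]}(t).$$ -/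

import Mathlib

namespace Polyomino

/-- A cell of `ℤ²` is represented by its lower left corner. -/
abbrev Cell : Type := ℤ × ℤ

/-- A vertex is a point of `ℤ²`. -/
abbrev Vertex : Type := ℤ × ℤ

/-- The four corners of the cell with lower left corner `C`. -/
def cellVertices (C : Cell) : Finset Vertex :=
  {C, C + (1, 0), C + (0, 1), C + (1, 1)}

/-- The four edges of a cell, each given by its two endpoints. -/
def cellEdges (C : Cell) : Finset (Finset Vertex) :=
  {{C, C + (0, 1)}, {C + (0, 1), C + (1, 1)}, {C + (1, 1), C + (1, 0)}, {C, C + (1, 0)}}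

/-- The vertex set `V(P)` of a finite collection of cells. -/
def vertexSet (P : Finset Cell) : Finset Vertex :=
  P.biUnion cellVertices

/-- The interval `[a, b]` of `ℤ²` is a proper interval and all the cells it contains
belong to `P`. -/
def IsInnerInterval (P : Finset Cell) (a b : Vertex) : Prop :=
  a.1 < b.1 ∧ a.2 < b.2 ∧ ∀ C : Cell, a ≤ C → C + (1, 1) ≤ b → C ∈ P

/-- The polyomino ideal, generated by the inner 2-minors `x_a x_b - x_c x_d`, where `[a, b]` is
an inner interval with anti-diagonal corners `c` (upper left) and `d` (lower right). The corners
of an inner interval of `P` always lie in `V(P)`. -/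
noncomputable def polyominoIdeal (K : Type*) [Field K] (P : Finset Cell) :
    Ideal (MvPolynomial (vertexSet P) K) :=
  Ideal.span {f | ∃ a b c d : vertexSet P,
    IsInnerInterval P a b ∧
    (c : Vertex) = ((a : Vertex).1, (b : Vertex).2) ∧
    (d : Vertex) = ((b : Vertex).1, (a : Vertex).2) ∧
    f = MvPolynomial.X a * MvPolynomial.X b - MvPolynomial.X c * MvPolynomial.X d}

/-- The coordinate ring `K[P]`. -/
abbrev CoordinateRing (K : Type*) [Field K] (P : Finset Cell) : Type _ :=
  MvPolynomial (vertexSet P) K ⧸ polyominoIdeal K P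

/-- The graded component `K[P]_k`: the image of the forms of degree `k` in the quotient. -/
noncomputable def gradedPiece (K : Type*) [Field K] (P : Finset Cell) (k : ℕ) :
    Submodule K (CoordinateRing K P) :=
  (MvPolynomial.homogeneousSubmodule (vertexSet P) K k).map
    (Ideal.Quotient.mkₐ K (polyominoIdeal K P)).toLinearMap

/-- The Hilbert function `k ↦ dim_K K[P]_k`. -/
noncomputable def hilbertFunction (K : Type*) [Field K] (P : Finset Cell) (k : ℕ) : ℕ :=
  Module.finrank K (gradedPiece K P k)

/-- The Hilbert–Poincaré series of `K[P]`. -/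
noncomputable def hilbertSeries (K : Type*) [Field K] (P : Finset Cell) : PowerSeries ℚ :=
  PowerSeries.mk fun k => (hilbertFunction K P k : ℚ)

/-- `P` is a closed path: its cells form a cyclic sequence (indexed modulo `n`, with `n > 5`) of
distinct cells, consecutive ones sharing a common edge, and such that cells at cyclic distance
more than two have no common vertex. -/
def IsClosedPath (P : Finset Cell) : Prop :=
  ∃ n : ℕ, 5 < n ∧ ∃ A : ZMod n → Cell,
    (P : Set Cell) = Set.range A ∧
    (∀ i, cellVertices (A i) ∩ cellVertices (A (i + 1)) ∈
      cellEdges (A i) ∩ cellEdges (A (i + 1))) ∧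
    (∀ i j, i ≠ j → A i ≠ A j) ∧
    (∀ i j, j ∉ ({i - 2, i - 1, i, i + 1, i + 2} : Set (ZMod n)) →
      cellVertices (A i) ∩ cellVertices (A j) = ∅)

/-- The cell interval `[C, D]` is a horizontal block of `P` of rank at least two. -/
def IsHorizontalBlock (P : Finset Cell) (C D : Cell) : Prop :=
  C ≤ D ∧ C.2 = D.2 ∧ 2 ≤ (Finset.Icc C D).card ∧ Finset.Icc C D ⊆ P

/-- The cell interval `[C, D]` is a vertical block of `P` of rank at least two. -/
def IsVerticalBlock (P : Finset Cell) (C D : Cell) : Prop :=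
  C ≤ D ∧ C.1 = D.1 ∧ 2 ≤ (Finset.Icc C D).card ∧ Finset.Icc C D ⊆ P

/-- `P` contains a configuration `W`, made of a horizontal block `[As, A₁]` with rightmost cell
`A₁`, a vertical block `[B₁, Br]` with lowest cell `B₁`, and a further cell `A`. The two blocks meet
exactly in the lower right corner `b = A + (1, 0)` of `A`, which is the upper right corner of `A₁`
and the lower left corner of `B₁`. -/
structure IsConfigurationW (P : Finset Cell) (A As A₁ B₁ Br : Cell) : Prop where
  mem : A ∈ P
  horizontal : IsHorizontalBlock P As A₁
  vertical : IsVerticalBlock P B₁ Br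
  notMem : A ∉ Finset.Icc As A₁ ∪ Finset.Icc B₁ Br
  inter : vertexSet (Finset.Icc As A₁) ∩ vertexSet (Finset.Icc B₁ Br) = {A + (1, 0)}
  corner_A₁ : A₁ + (1, 1) = A + (1, 0)
  corner_B₁ : B₁ = A + (1, 0)

end Polyomino

namespace Polyomino

/-! Write `A = (x, y)`, `u = (x, y + 1)`, and let `T` be the set of the vertices `(x + 1, y)`, `(x +
1, y - 1)`, `(x + 2, y)`. The vertex `u` lies in no cell of P other than `A`, and the inner
intervals through `A` are exactly those with anti-diagonal corners `u` and some `v ∈ T`. So K[P] is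
K[Q][x_u] modulo the relations x_u x_v = q_v for `v ∈ T`, where q_v is the product of the diagonal
variables. Let J be the ideal (x_v : v ∈ T) of K[Q]; then K[Q]/J = K[Q₁]. The relations rewrite
every element as r + ∑ s_k x_u^k with r over K[Q] and each s_k, k ≥ 1, over K[Q₁]. Uniqueness holds
because x_v ↦ q_v is a well-defined K[Q]-linear map J → K[Q] (`sum_mul_cornerProduct_mem`), so the
relations create no new elements in degree zero in x_u (`eq_zero_of_mem_span_X_mul_sub`). As graded
spaces, K[P] = K[Q] ⊕ ⨁_{k ≥ 1} x_u^k K[Q₁], which gives the factor t/(1 - t). -/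

/-! ### Algebraic preliminaries. -/

open MvPolynomial in
/-- If `q i * X j ≡ q j * X i` modulo `I` for `i, j ∈ s`, there is a linear map that sends `X i * f`
to `q i * f` modulo `I` for `i ∈ s` and commutes with the other variables. -/
theorem exists_linearMap_X_mul {σ K : Type*} [Field K] (I : Ideal (MvPolynomial σ K))
    (q : σ → MvPolynomial σ K) (s : Finset σ)
    (hq : ∀ i ∈ s, ∀ j ∈ s, q i * X j - q j * X i ∈ I) :
    ∃ φ : MvPolynomial σ K →ₗ[K] MvPolynomial σ K,
      (∀ i ∈ s, ∀ f, φ (X i * f) - q i * f ∈ I) ∧ ∀ v ∉ s, ∀ f, φ (X v * f) = X v * φ f := by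
  classical
  induction s using Finset.induction_on with
  | empty => exact ⟨0, by simp, by simp⟩
  | insert b s hb ih =>
    obtain ⟨φ, h₁, h₂⟩ := ih fun i hi j hj =>
      hq i (Finset.mem_insert_of_mem hi) j (Finset.mem_insert_of_mem hj)
    let D : MvPolynomial σ K →ₗ[K] MvPolynomial σ K :=
      { toFun := fun f => f.divMonomial (Finsupp.single b 1)
        map_add' := fun f g => add_divMonomial f g _
        map_smul' := fun c f => by ext m; simp }
    have hD : ∀ f, f = X b * D f + f.modMonomial (Finsupp.single b 1) := fun f =>
      (divMonomial_add_modMonomial_single f b).symm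
    let N : MvPolynomial σ K →ₗ[K] MvPolynomial σ K :=
      LinearMap.id - (LinearMap.mulLeft K (X b)).comp D
    have hN : ∀ f, N f = f - X b * D f := fun f => rfl
    have hDb : ∀ f, D (X b * f) = f := fun f => X_mul_divMonomial b f
    have hDv : ∀ v, v ≠ b → ∀ f, D (X v * f) = X v * D f := by
      intro v hv f
      refine (eq_divMonomial_single (r := X v * f.modMonomial (Finsupp.single b 1)) ?_ ?_).symm
      · conv_lhs => rw [hD f]
        ring
      · intro m hm
        rw [support_X_mul, Finset.mem_map] at hm
        obtain ⟨m', hm', rfl⟩ := hm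
        have h0 : m' b = 0 := by
          by_contra hne
          exact mem_support_iff.1 hm' (coeff_modMonomial_of_le _
            (by simpa [Nat.one_le_iff_ne_zero] using hne))
        simp [h0, hv]
    have hNv : ∀ v, v ≠ b → ∀ f, N (X v * f) = X v * N f := by
      intro v hv f
      rw [hN, hN, hDv v hv]
      ring
    -- `D f` is the quotient of `f` by `X b` and `N f` the remainder. On the multiples of `X b`,
    -- this variable is replaced by `q b`; the remainder is left to the map for `s`. The two rules
    -- agree modulo `I` by `hq`.
    refine ⟨(LinearMap.mulLeft K (q b)).comp D + φ.comp N, ?_, ?_⟩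
    · intro i hi f
      simp only [LinearMap.add_apply, LinearMap.comp_apply, LinearMap.mulLeft_apply]
      by_cases hib : i = b
      · subst hib
        simp [hN, hDb]
      · have his : i ∈ s := (Finset.mem_insert.1 hi).resolve_left hib
        rw [hDv i hib, hNv i hib]
        have e : q b * (X i * D f) + φ (X i * N f) - q i * f =
            (φ (X i * N f) - q i * N f) + (q b * X i - q i * X b) * D f := by
          rw [hN]; ring
        rw [e]
        exact I.add_mem (h₁ i his _)
          (I.mul_mem_right _ (hq b (Finset.mem_insert_self _ _) i hi))
    · intro v hv f
      rw [Finset.mem_insert, not_or] at hv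
      simp only [LinearMap.add_apply, LinearMap.comp_apply, LinearMap.mulLeft_apply]
      rw [hDv v hv.1, hNv v hv.1, h₂ v hv.2]
      ring

open Polynomial in
/-- If every syzygy of `p` is a syzygy of `q`, a polynomial in the ideal generated by the
`X * p i - q i` whose coefficients in positive degree lie in a set that meets the ideal `(p i)`
only in `0` vanishes. -/
theorem eq_zero_of_mem_span_X_mul_sub {R ι : Type*} [CommRing R] [Fintype ι] (p q : ι → R)
    (hsyz : ∀ a : ι → R, ∑ i, a i * p i = 0 → ∑ i, a i * q i = 0) (S : Set R)
    (hS : ∀ c ∈ S, c ∈ Ideal.span (Set.range p) → c = 0) (f : R[X])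
    (hf : f ∈ Ideal.span (Set.range fun i => X * C (p i) - C (q i)))
    (hfS : ∀ k, f.coeff (k + 1) ∈ S) : f = 0 := by
  obtain ⟨g, rfl⟩ := (Ideal.mem_span_range_iff_exists_fun).1 hf
  have hc : ∀ k, (∑ i, g i * (X * C (p i) - C (q i))).coeff (k + 1) =
      ∑ i, (g i).coeff k * p i - ∑ i, (g i).coeff (k + 1) * q i := by
    intro k
    rw [finsetSum_coeff, ← Finset.sum_sub_distrib]
    refine Finset.sum_congr rfl fun i _ => ?_
    rw [mul_sub, ← mul_assoc, coeff_sub, coeff_mul_C, coeff_mul_C, coeff_mul_X]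
  have hc0 : (∑ i, g i * (X * C (p i) - C (q i))).coeff 0 = - ∑ i, (g i).coeff 0 * q i := by
    rw [finsetSum_coeff, ← Finset.sum_neg_distrib]
    refine Finset.sum_congr rfl fun i _ => ?_
    rw [mul_sub, ← mul_assoc, coeff_sub, coeff_mul_C, coeff_mul_C, coeff_mul_X_zero]
    ring
  -- If the `q`-sum in degree `k + 1` vanishes, the coefficient of degree `k + 1` lies both in `S`
  -- and in the ideal `(p i)`, hence is zero.
  have step : ∀ k, ∑ i, (g i).coeff (k + 1) * q i = 0 → ∑ i, (g i).coeff k * p i = 0 := by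
    intro k hk
    have h := hc k
    rw [hk, sub_zero] at h
    rw [← h]
    refine hS _ (hfS k) ?_
    rw [h]
    exact Ideal.sum_mem _ fun i _ => Ideal.mul_mem_left _ _ (Ideal.subset_span ⟨i, rfl⟩)
  have hq : ∀ k, ∑ i, (g i).coeff k * q i = 0 := by
    let m := Finset.univ.sup fun i => (g i).natDegree
    have large : ∀ k, m < k → ∑ i, (g i).coeff k * q i = 0 := fun k hk =>
      Finset.sum_eq_zero fun i _ => by
        rw [coeff_eq_zero_of_natDegree_lt
          ((Finset.le_sup (f := fun i => (g i).natDegree) (Finset.mem_univ i)).trans_lt hk),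
          zero_mul]
    -- Descending induction on `k`, starting above all degrees of the `g i`: `step` passes from `q`
    -- in degree `k + 1` to `p` in degree `k`, and `hsyz` from `p` to `q`.
    have main : ∀ j k, m + 1 ≤ k + j → ∑ i, (g i).coeff k * q i = 0 := by
      intro j
      induction j with
      | zero => exact fun k hk => large k (by omega)
      | succ j ih => exact fun k hk => hsyz _ (step k (ih (k + 1) (by omega)))
    exact fun k => main (m + 1) k (by omega)
  ext k
  cases k with
  | zero => rw [hc0, hq]; simp
  | succ k => rw [hc, hq, step k (hq _)]; simp

/-- Linear maps with the same kernel have ranges of the same dimension. -/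
theorem finrank_range_eq_of_ker_eq {K M N N' : Type*} [Field K] [AddCommGroup M] [Module K M]
    [AddCommGroup N] [Module K N] [AddCommGroup N'] [Module K N'] (f : M →ₗ[K] N) (g : M →ₗ[K] N')
    (h : LinearMap.ker f = LinearMap.ker g) :
    Module.finrank K (LinearMap.range f) = Module.finrank K (LinearMap.range g) :=
  (f.quotKerEquivRange.symm.trans
    ((Submodule.quotEquivOfEq _ _ h).trans g.quotKerEquivRange)).finrank_eq

/-- Coefficients of `X / (1 - X)` times a series. -/
theorem coeff_X_mul_inv_one_sub_X_mul (f : PowerSeries ℚ) (n : ℕ) :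
    PowerSeries.coeff n (PowerSeries.X * (1 - PowerSeries.X)⁻¹ * f) =
      ∑ j ∈ Finset.range n, PowerSeries.coeff j f := by
  have h : (1 - PowerSeries.X : PowerSeries ℚ)⁻¹ = PowerSeries.mk 1 := by
    rw [PowerSeries.inv_eq_iff_mul_eq_one (by simp)]
    exact PowerSeries.mk_one_mul_one_sub_eq_one ℚ
  rw [h, mul_assoc, mul_comm (PowerSeries.mk 1)]
  cases n with
  | zero => simp
  | succ n =>
    rw [PowerSeries.coeff_succ_X_mul, PowerSeries.coeff_mul,
      Finset.Nat.sum_antidiagonal_eq_sum_range_succ_mk]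
    simp

/-! ### The shape of a closed path around the configuration. -/

/-- Two cells share an edge. -/
def Adjacent (C D : Cell) : Prop :=
  D = C + (1, 0) ∨ D = C + (0, 1) ∨ C = D + (1, 0) ∨ C = D + (0, 1)

theorem mem_cellVertices {C : Cell} {v : Vertex} :
    v ∈ cellVertices C ↔ (v.1 = C.1 ∨ v.1 = C.1 + 1) ∧ (v.2 = C.2 ∨ v.2 = C.2 + 1) := by
  obtain ⟨a, b⟩ := C
  obtain ⟨x, y⟩ := v
  simp only [cellVertices, Finset.mem_insert, Finset.mem_singleton, Prod.mk_add_mk, Prod.mk.injEq]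
  omega

theorem mem_vertexSet {P : Finset Cell} {v : Vertex} :
    v ∈ vertexSet P ↔ ∃ C ∈ P, v ∈ cellVertices C := by
  simp [vertexSet]

theorem adjacent_of_inter_mem_cellEdges {C D : Cell} (hne : C ≠ D)
    (h : cellVertices C ∩ cellVertices D ∈ cellEdges C) : Adjacent C D := by
  obtain ⟨a, b⟩ := C
  obtain ⟨c, d⟩ := D
  have key : ∀ v w : Vertex, cellVertices (a, b) ∩ cellVertices (c, d) = {v, w} →
      v ∈ cellVertices (c, d) ∧ w ∈ cellVertices (c, d) := by
    intro v w e
    constructor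
    · exact (Finset.mem_inter.1 (e ▸ Finset.mem_insert_self v {w})).2
    · exact (Finset.mem_inter.1 (e ▸ Finset.mem_insert_of_mem (Finset.mem_singleton_self w))).2
  simp only [cellEdges, Finset.mem_insert, Finset.mem_singleton] at h
  simp only [Adjacent, Prod.mk_add_mk, Prod.mk.injEq]
  rw [Ne, Prod.mk.injEq] at hne
  rcases h with h | h | h | h <;>
  · have := key _ _ h
    simp only [mem_cellVertices, Prod.mk_add_mk] at this
    omega

theorem Adjacent.symm {C D : Cell} (h : Adjacent C D) : Adjacent D C := by
  unfold Adjacent at *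
  tauto

/-- A cell of a closed path is adjacent to at most two of its cells. -/
theorem IsClosedPath.exists_neighbors {P : Finset Cell} (hP : IsClosedPath P) {C : Cell}
    (hC : C ∈ P) : ∃ X Y : Cell, (∀ D ∈ P, Adjacent C D → D = X ∨ D = Y) ∧
      ∀ D ∈ P, (cellVertices C ∩ cellVertices D).Nonempty → D = C ∨ Adjacent C D ∨
        ∃ E ∈ P, Adjacent C E ∧ Adjacent E D := by
  obtain ⟨n, hn, A, hPA, hedge, hinj, hdisj⟩ := hP
  have hmem : ∀ D, D ∈ P ↔ ∃ i, A i = D := fun D => by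
    rw [← Finset.mem_coe, hPA, Set.mem_range]
  have hne1 : ∀ i : ZMod n, i ≠ i + 1 := by
    intro i hi
    have : Fact (1 < n) := ⟨by omega⟩
    simp at hi
  have hadj : ∀ i, Adjacent (A i) (A (i + 1)) := fun i =>
    adjacent_of_inter_mem_cellEdges (hinj _ _ (hne1 i)) (Finset.mem_inter.1 (hedge i)).1
  have hadj' : ∀ i, Adjacent (A i) (A (i - 1)) := fun i => by
    simpa using (hadj (i - 1)).symm
  obtain ⟨i, rfl⟩ := (hmem C).1 hC
  have htouch : ∀ D ∈ P, (cellVertices (A i) ∩ cellVertices D).Nonempty →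
      D = A i ∨ (D = A (i - 1) ∨ D = A (i + 1)) ∨
        ∃ E ∈ P, Adjacent (A i) E ∧ Adjacent E D := by
    intro D hD h
    obtain ⟨j, rfl⟩ := (hmem D).1 hD
    by_cases hj : j ∈ ({i - 2, i - 1, i, i + 1, i + 2} : Set (ZMod n))
    · rcases hj with rfl | rfl | rfl | rfl | rfl
      · refine Or.inr (Or.inr ⟨A (i - 1), (hmem _).2 ⟨_, rfl⟩, hadj' i, ?_⟩)
        have := hadj' (i - 1)
        rwa [sub_sub, one_add_one_eq_two] at this
      · exact Or.inr (Or.inl (Or.inl rfl))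
      · exact Or.inl rfl
      · exact Or.inr (Or.inl (Or.inr rfl))
      · refine Or.inr (Or.inr ⟨A (i + 1), (hmem _).2 ⟨_, rfl⟩, hadj i, ?_⟩)
        have := hadj (i + 1)
        rwa [add_assoc, one_add_one_eq_two] at this
    · rw [hdisj i j hj] at h
      exact absurd h Finset.not_nonempty_empty
  refine ⟨A (i - 1), A (i + 1), fun D hD hCD => ?_, fun D hD h => ?_⟩
  · have hnon : (cellVertices (A i) ∩ cellVertices D).Nonempty := by
      rcases hCD with h | h | h | h
      · exact ⟨D, by simp [mem_cellVertices, h]⟩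
      · exact ⟨D, by simp [mem_cellVertices, h]⟩
      · exact ⟨A i, by simp [mem_cellVertices, h]⟩
      · exact ⟨A i, by simp [mem_cellVertices, h]⟩
    rcases htouch D hD hnon with h | h | ⟨E, -, h₁, h₂⟩
    · simp [Adjacent, h] at hCD
    · exact h
    -- Adjacent cells have coordinate sums of opposite parity, so a cell two steps away from `A i`
    -- is not adjacent to it.
    · exfalso
      simp only [Adjacent, Prod.ext_iff, Prod.fst_add, Prod.snd_add] at hCD h₁ h₂
      omega
  · rcases htouch D hD h with h | (h | h) | h
    · exact Or.inl h
    · exact Or.inr (Or.inl (h ▸ hadj' i))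
    · exact Or.inr (Or.inl (h ▸ hadj i))
    · exact Or.inr (Or.inr h)

/-- The cell `(x, y)` is a corner of `P`: its only neighbours are the cell below, followed by the
cell to the left, and the cell on the right, followed by the cell above. -/
structure IsCorner (P : Finset Cell) (x y : ℤ) : Prop where
  mem : (x, y) ∈ P
  mem_below : (x, y - 1) ∈ P
  mem_right : (x + 1, y) ∈ P
  mem_below_left : (x - 1, y - 1) ∈ P
  mem_right_above : (x + 1, y + 1) ∈ P
  left : (x - 1, y) ∉ P
  above : (x, y + 1) ∉ P
  above_left : (x - 1, y + 1) ∉ P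
  below_right : (x + 1, y - 1) ∉ P
  below_below : (x, y - 2) ∉ P
  below_below_right : (x + 1, y - 2) ∉ P
  right_right : (x + 2, y) ∉ P
  right_right_below : (x + 2, y - 1) ∉ P

theorem IsClosedPath.notMem_of_adjacent {P : Finset Cell} (hP : IsClosedPath P) {C D E F : Cell}
    (hC : C ∈ P) (hD : D ∈ P) (hE : E ∈ P) (hCD : Adjacent C D) (hCE : Adjacent C E) (hDE : D ≠ E)
    (hCF : Adjacent C F) (hFD : F ≠ D) (hFE : F ≠ E) : F ∉ P := by
  intro hF
  obtain ⟨X, Y, h, -⟩ := hP.exists_neighbors hC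
  have h₁ := h D hD hCD
  have h₂ := h E hE hCE
  have h₃ := h F hF hCF
  grind

/-- Each of `A`, `A₁`, `B₁` already has two neighbours in `P`; for `A₁` and `B₁` this uses that the
blocks have rank at least two. This excludes all further neighbours by edge, and the excluded edge
neighbours in turn exclude the diagonal cells. -/
theorem IsConfigurationW.isCorner {P : Finset Cell} (hP : IsClosedPath P)
    {A As A₁ B₁ Br : Cell} (hW : IsConfigurationW P A As A₁ B₁ Br) :
    IsCorner P A.1 A.2 ∧ A₁ = (A.1, A.2 - 1) ∧ B₁ = (A.1 + 1, A.2) := by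
  obtain ⟨x, y⟩ := A
  obtain ⟨hA, ⟨hAs, hAs2, hcard, hAsub⟩, ⟨hBr, hBr1, hcard', hBsub⟩, -, -, hA₁, rfl⟩ := hW
  have hA₁' : A₁ = (x, y - 1) := by
    simp only [Prod.ext_iff, Prod.fst_add, Prod.snd_add] at hA₁ ⊢
    omega
  subst hA₁'
  obtain ⟨a, b⟩ := As
  obtain ⟨c, d⟩ := Br
  simp only [Prod.mk_add_mk, add_zero] at *
  simp only [Prod.mk_le_mk] at hAs hBr
  subst hAs2 hBr1
  have ha : a < x := by
    rcases hAs.1.lt_or_eq with h | rfl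
    · exact h
    · simp at hcard
  have hd : y < d := by
    rcases hBr.2.lt_or_eq with h | rfl
    · exact h
    · simp at hcard'
  have m1 : (x, y - 1) ∈ P := hAsub (by simp; omega)
  have m2 : (x - 1, y - 1) ∈ P := hAsub (by simp; omega)
  have m3 : (x + 1, y) ∈ P := hBsub (by simp; omega)
  have m4 : (x + 1, y + 1) ∈ P := hBsub (by simp; omega)
  have tac : ∀ i j k l : ℤ, Adjacent (i, j) (k, l) ↔
      (k = i + 1 ∧ l = j) ∨ (k = i ∧ l = j + 1) ∨ (i = k + 1 ∧ j = l) ∨ (i = k ∧ j = l + 1) := by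
    intro i j k l
    simp [Adjacent]
  have n1 : (x - 1, y) ∉ P := by
    apply hP.notMem_of_adjacent hA m1 m3 <;> simp [tac]
    omega
  have n2 : (x, y + 1) ∉ P := by
    apply hP.notMem_of_adjacent hA m1 m3 <;> simp [tac]
    omega
  have n3 : (x + 1, y - 1) ∉ P := by
    apply hP.notMem_of_adjacent m1 hA m2 <;> simp [tac] <;> omega
  have n4 : (x, y - 2) ∉ P := by
    apply hP.notMem_of_adjacent m1 hA m2 <;> simp [tac] <;> omega
  have n5 : (x + 2, y) ∉ P := by
    apply hP.notMem_of_adjacent m3 hA m4 <;> simp [tac]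
    omega
  -- Diagonal cells share a vertex but no edge, so if both lie in a closed path, one of the two
  -- cells adjacent to both lies in it as well.
  have diag : ∀ i j k l : ℤ, (i, j) ∈ P → (k = i + 1 ∨ k = i - 1) → (l = j + 1 ∨ l = j - 1) →
      (i, l) ∉ P → (k, j) ∉ P → (k, l) ∉ P := by
    intro i j k l hC hk hl h₁ h₂ hD
    obtain ⟨-, -, -, h⟩ := hP.exists_neighbors hC
    have hn : (cellVertices (i, j) ∩ cellVertices (k, l)).Nonempty :=
      ⟨(max i k, max j l), by
        simp only [Finset.mem_inter, mem_cellVertices]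
        omega⟩
    rcases h _ hD hn with h | h | ⟨⟨e, f⟩, hE, h, h'⟩
    · simp at h; omega
    · simp [tac] at h; omega
    · rw [tac] at h h'
      have : (e = i ∧ f = l) ∨ (e = k ∧ f = j) := by omega
      rcases this with ⟨rfl, rfl⟩ | ⟨rfl, rfl⟩
      · exact h₁ hE
      · exact h₂ hE
  refine ⟨⟨hA, m1, m3, m2, m4, n1, n2, ?_, n3, n4, ?_, n5, ?_⟩, by simp⟩
  · exact diag x y _ _ hA (by omega) (by omega) n2 n1
  · exact diag x (y - 1) _ _ m1 (by omega) (by omega) n4 n3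
  · exact diag (x + 1) y _ _ m3 (by omega) (by omega) n3 n5

/-! ### Vertices and inner intervals near the corner. -/

theorem isInnerInterval_iff {P : Finset Cell} {a b : Vertex} : IsInnerInterval P a b ↔
    a.1 < b.1 ∧ a.2 < b.2 ∧
      ∀ i j, a.1 ≤ i → a.2 ≤ j → i + 1 ≤ b.1 → j + 1 ≤ b.2 → (i, j) ∈ P := by
  refine and_congr_right fun _ => and_congr_right fun _ =>
    ⟨fun h i j h₁ h₂ h₃ h₄ => h _ ⟨h₁, h₂⟩ ⟨h₃, h₄⟩, fun h C h₁ h₂ => ?_⟩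
  exact h C.1 C.2 h₁.1 h₁.2 h₂.1 h₂.2

theorem IsInnerInterval.mono {P Q : Finset Cell} (h : P ⊆ Q) {a b : Vertex}
    (hab : IsInnerInterval P a b) : IsInnerInterval Q a b :=
  ⟨hab.1, hab.2.1, fun C h₁ h₂ => h (hab.2.2 C h₁ h₂)⟩

theorem IsInnerInterval.mem_vertexSet {P : Finset Cell} {a b : Vertex}
    (h : IsInnerInterval P a b) {v : Vertex} (h₁ : v.1 = a.1 ∨ v.1 = b.1)
    (h₂ : v.2 = a.2 ∨ v.2 = b.2) : v ∈ vertexSet P := by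
  rw [isInnerInterval_iff] at h
  rw [Polyomino.mem_vertexSet]
  refine ⟨(if v.1 = a.1 then v.1 else v.1 - 1, if v.2 = a.2 then v.2 else v.2 - 1),
    h.2.2 _ _ ?_ ?_ ?_ ?_, mem_cellVertices.2 ⟨?_, ?_⟩⟩ <;>
  · split_ifs <;> omega

/-- The vertices that a corner cell of `P` and its two neighbours do not share with the rest of `P`,
apart from the upper left vertex of the corner cell. -/
def cornerVertices (x y : ℤ) : Finset Vertex :=
  {(x + 1, y), (x + 1, y - 1), (x + 2, y)}

theorem mem_cornerVertices {x y i j : ℤ} : (i, j) ∈ cornerVertices x y ↔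
    (i = x + 1 ∧ j = y) ∨ (i = x + 1 ∧ j = y - 1) ∨ (i = x + 2 ∧ j = y) := by
  simp [cornerVertices]

namespace IsCorner

variable {P : Finset Cell} {x y : ℤ}

theorem notMem_vertexSet (h : IsCorner P x y) : (x, y + 1) ∉ vertexSet (P \ {(x, y)}) := by
  rw [mem_vertexSet]
  rintro ⟨⟨i, j⟩, hC, hv⟩
  simp only [mem_cellVertices, Finset.mem_sdiff, Finset.mem_singleton, Prod.mk.injEq] at hC hv
  have h₁ := h.left
  have h₂ := h.above
  have h₃ := h.above_left
  have : (i = x - 1 ∧ j = y) ∨ (i = x ∧ j = y + 1) ∨ (i = x - 1 ∧ j = y + 1) := by omega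
  rcases this with ⟨rfl, rfl⟩ | ⟨rfl, rfl⟩ | ⟨rfl, rfl⟩
  · exact h₁ hC.1
  · exact h₂ hC.1
  · exact h₃ hC.1

theorem mem_vertexSet_iff (h : IsCorner P x y) (v : Vertex) :
    v ∈ vertexSet P ↔ v = (x, y + 1) ∨ v ∈ vertexSet (P \ {(x, y)}) := by
  obtain ⟨k, l⟩ := v
  simp only [mem_vertexSet, Finset.mem_sdiff, Finset.mem_singleton]
  constructor
  · rintro ⟨⟨i, j⟩, hC, hv⟩
    by_cases hij : (i, j) = (x, y)
    · rw [hij, mem_cellVertices] at hv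
      dsimp only at hv
      have : (k = x ∧ l = y) ∨ (k = x + 1 ∧ (l = y ∨ l = y + 1)) ∨ (k = x ∧ l = y + 1) := by omega
      rcases this with ⟨rfl, rfl⟩ | ⟨rfl, hl⟩ | ⟨rfl, rfl⟩
      · exact Or.inr ⟨_, ⟨h.mem_below, by simp⟩, by simp [mem_cellVertices]⟩
      · exact Or.inr ⟨_, ⟨h.mem_right, by simp⟩, by simp [mem_cellVertices, hl]⟩
      · exact Or.inl rfl
    · exact Or.inr ⟨_, ⟨hC, hij⟩, hv⟩
  · rintro (hv | ⟨C, hC, hv⟩)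
    · rw [hv]
      exact ⟨_, h.mem, by simp [mem_cellVertices]⟩
    · exact ⟨C, hC.1, hv⟩

/-- The remaining vertices of the two deleted neighbours are also vertices of the next cells `(x -
1, y - 1)` and `(x + 1, y + 1)` of the blocks. -/
theorem mem_vertexSet_sdiff_iff (h : IsCorner P x y) (v : Vertex) :
    v ∈ vertexSet (P \ {(x, y), (x, y - 1), (x + 1, y)}) ↔
      v ∈ vertexSet (P \ {(x, y)}) ∧ v ∉ cornerVertices x y := by
  obtain ⟨k, l⟩ := v
  simp only [mem_vertexSet, Finset.mem_sdiff, Finset.mem_singleton, Finset.mem_insert,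
    mem_cornerVertices]
  constructor
  · rintro ⟨⟨i, j⟩, hC, hv⟩
    refine ⟨⟨_, ⟨hC.1, fun e => hC.2 (Or.inl e)⟩, hv⟩, fun hkl => ?_⟩
    simp only [mem_cellVertices, Prod.mk.injEq] at hC hv
    have h₁ := h.below_right
    have h₂ := h.below_below
    have h₃ := h.below_below_right
    have h₄ := h.right_right
    have h₅ := h.right_right_below
    have : (i = x + 1 ∧ j = y - 1) ∨ (i = x ∧ j = y - 2) ∨ (i = x + 1 ∧ j = y - 2) ∨
        (i = x + 2 ∧ j = y) ∨ (i = x + 2 ∧ j = y - 1) := by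
      rcases hkl with ⟨rfl, rfl⟩ | ⟨rfl, rfl⟩ | ⟨rfl, rfl⟩ <;> omega
    rcases this with ⟨rfl, rfl⟩ | ⟨rfl, rfl⟩ | ⟨rfl, rfl⟩ | ⟨rfl, rfl⟩ | ⟨rfl, rfl⟩
    · exact h₁ hC.1
    · exact h₂ hC.1
    · exact h₃ hC.1
    · exact h₄ hC.1
    · exact h₅ hC.1
  · rintro ⟨⟨⟨i, j⟩, hC, hv⟩, hkl⟩
    by_cases h₁ : (i, j) = (x, y - 1)
    · rw [h₁, mem_cellVertices] at hv
      dsimp only at hv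
      exact ⟨_, ⟨h.mem_below_left, by simp⟩, mem_cellVertices.2 (by dsimp only; omega)⟩
    · by_cases h₂ : (i, j) = (x + 1, y)
      · rw [h₂, mem_cellVertices] at hv
        dsimp only at hv
        exact ⟨_, ⟨h.mem_right_above, by simp⟩, mem_cellVertices.2 (by dsimp only; omega)⟩
      · exact ⟨_, ⟨hC.1, by tauto⟩, hv⟩

/-- The missing cells around `(x, y)` leave only three intervals through it: the cell alone, with
the cell below, or with the cell on the right. All have `(x, y + 1)` as upper left corner. -/
theorem isInnerInterval_cases (h : IsCorner P x y) {a b : Vertex} (hab : IsInnerInterval P a b) :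
    IsInnerInterval (P \ {(x, y)}) a b ∨
      ∃ v ∈ cornerVertices x y, a = (x, v.2) ∧ b = (v.1, y + 1) := by
  obtain ⟨a₁, a₂⟩ := a
  obtain ⟨b₁, b₂⟩ := b
  simp only [isInnerInterval_iff, Finset.mem_sdiff, Finset.mem_singleton] at hab ⊢
  obtain ⟨h₁, h₂, hab⟩ := hab
  by_cases hA : a₁ ≤ x ∧ a₂ ≤ y ∧ x + 1 ≤ b₁ ∧ y + 1 ≤ b₂
  · right
    have hn : ∀ i j, (i, j) ∉ P → ¬(a₁ ≤ i ∧ a₂ ≤ j ∧ i + 1 ≤ b₁ ∧ j + 1 ≤ b₂) :=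
      fun i j hij e => hij (hab i j e.1 e.2.1 e.2.2.1 e.2.2.2)
    have k₁ := hn _ _ h.left
    have k₂ := hn _ _ h.above
    have k₃ := hn _ _ h.below_right
    have k₄ := hn _ _ h.below_below
    have k₅ := hn _ _ h.right_right
    refine ⟨(b₁, a₂), mem_cornerVertices.2 (by omega), ?_, ?_⟩ <;>
    · rw [Prod.mk.injEq]
      omega
  · left
    refine ⟨h₁, h₂, fun i j hi hj hi' hj' => ⟨hab i j hi hj hi' hj', ?_⟩⟩
    rw [Prod.mk.injEq]
    omega

theorem isInnerInterval_of_mem_cornerVertices (h : IsCorner P x y) {v : Vertex}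
    (hv : v ∈ cornerVertices x y) : IsInnerInterval P (x, v.2) (v.1, y + 1) := by
  obtain ⟨k, l⟩ := v
  rw [mem_cornerVertices] at hv
  rw [isInnerInterval_iff]
  dsimp only
  refine ⟨by omega, by omega, fun i j hi hj hi' hj' => ?_⟩
  have : (i = x ∧ j = y) ∨ (i = x ∧ j = y - 1) ∨ (i = x + 1 ∧ j = y) := by omega
  rcases this with ⟨rfl, rfl⟩ | ⟨rfl, rfl⟩ | ⟨rfl, rfl⟩
  · exact h.mem
  · exact h.mem_below
  · exact h.mem_right

theorem isInnerInterval_below (h : IsCorner P x y) :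
    IsInnerInterval (P \ {(x, y)}) (x, y - 1) (x + 1, y) := by
  simp only [isInnerInterval_iff, Finset.mem_sdiff, Finset.mem_singleton]
  refine ⟨by omega, by omega, fun i j hi hj hi' hj' => ?_⟩
  obtain rfl : i = x := by omega
  obtain rfl : j = y - 1 := by omega
  exact ⟨h.mem_below, by simp⟩

theorem isInnerInterval_right (h : IsCorner P x y) :
    IsInnerInterval (P \ {(x, y)}) (x + 1, y) (x + 2, y + 1) := by
  simp only [isInnerInterval_iff, Finset.mem_sdiff, Finset.mem_singleton]
  refine ⟨by omega, by omega, fun i j hi hj hi' hj' => ?_⟩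
  obtain rfl : i = x + 1 := by omega
  obtain rfl : j = y := by omega
  exact ⟨h.mem_right, by simp⟩

/-- Without `(x, y)`, an interval through `(x, y - 1)` is a strip of height one ending there, and
one through `(x + 1, y)` is a strip of width one starting there. Deleting that end cell leaves
nothing or a shorter inner strip, whose minor is needed later. -/
theorem isInnerInterval_sdiff_cases (h : IsCorner P x y) {a b : Vertex}
    (hab : IsInnerInterval (P \ {(x, y)}) a b) :
    IsInnerInterval (P \ {(x, y), (x, y - 1), (x + 1, y)}) a b ∨
      (∃ i, a = (i, y - 1) ∧ b = (x + 1, y) ∧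
        (i = x ∨ IsInnerInterval (P \ {(x, y)}) (i, y - 1) (x, y)) ∧ i ≤ x) ∨
      ∃ j, a = (x + 1, y) ∧ b = (x + 2, j) ∧
        (j = y + 1 ∨ IsInnerInterval (P \ {(x, y)}) (x + 1, y + 1) (x + 2, j)) ∧ y + 1 ≤ j := by
  obtain ⟨a₁, a₂⟩ := a
  obtain ⟨b₁, b₂⟩ := b
  simp only [isInnerInterval_iff, Finset.mem_sdiff, Finset.mem_singleton,
    Finset.mem_insert] at hab ⊢
  obtain ⟨h₁, h₂, hab⟩ := hab
  have hn : ∀ i j, ¬((i, j) ∈ P ∧ ¬(i, j) = (x, y)) →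
      ¬(a₁ ≤ i ∧ a₂ ≤ j ∧ i + 1 ≤ b₁ ∧ j + 1 ≤ b₂) :=
    fun i j hij e => hij (hab i j e.1 e.2.1 e.2.2.1 e.2.2.2)
  have k₀ := hn x y fun e => e.2 rfl
  have k₁ := hn _ _ fun e => h.below_right e.1
  have k₂ := hn _ _ fun e => h.below_below e.1
  have k₃ := hn _ _ fun e => h.right_right e.1
  by_cases hA : a₁ ≤ x ∧ a₂ ≤ y - 1 ∧ x + 1 ≤ b₁ ∧ y ≤ b₂
  · right; left
    obtain rfl : a₂ = y - 1 := by omega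
    obtain rfl : b₁ = x + 1 := by omega
    obtain rfl : b₂ = y := by omega
    refine ⟨a₁, rfl, rfl, ?_, hA.1⟩
    refine or_iff_not_imp_left.2 fun hne => ⟨by omega, by omega, fun i j hi hj hi' hj' => ?_⟩
    exact hab i j hi hj (by omega) hj'
  · by_cases hB : a₁ ≤ x + 1 ∧ a₂ ≤ y ∧ x + 2 ≤ b₁ ∧ y + 1 ≤ b₂
    · right; right
      obtain rfl : a₁ = x + 1 := by omega
      obtain rfl : a₂ = y := by omega
      obtain rfl : b₁ = x + 2 := by omega
      refine ⟨b₂, rfl, rfl, ?_, hB.2.2.2⟩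
      refine or_iff_not_imp_left.2 fun hne => ⟨by omega, by omega, fun i j hi hj hi' hj' => ?_⟩
      exact hab i j hi (by omega) hi' hj'
    · left
      refine ⟨h₁, h₂, fun i j hi hj hi' hj' => ⟨(hab i j hi hj hi' hj').1, ?_⟩⟩
      simp only [Prod.mk.injEq]
      omega

end IsCorner

/-! ### Comparing the ideals in one polynomial ring. -/

open MvPolynomial

/-- The inner 2-minor of the interval `[a, b]`, in the polynomial ring on all vertices. -/
noncomputable def intervalMinor (K : Type*) [Field K] (a b : Vertex) : MvPolynomial Vertex K :=
  X a * X b - X (a.1, b.2) * X (b.1, a.2)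

/-- The ideal generated by the inner 2-minors of `P` in the polynomial ring on all vertices. -/
noncomputable def ambientIdeal (K : Type*) [Field K] (P : Finset Cell) :
    Ideal (MvPolynomial Vertex K) :=
  Ideal.span {f | ∃ a b, IsInnerInterval P a b ∧ f = intervalMinor K a b}

/-- Setting the variables outside of `V` to zero. -/
noncomputable def restrict (K : Type*) [Field K] (V : Finset Vertex) :
    MvPolynomial Vertex K →ₐ[K] MvPolynomial V K :=
  aeval fun v => if h : v ∈ V then X ⟨v, h⟩ else 0

variable {K : Type*} [Field K]

theorem intervalMinor_mem {P : Finset Cell} {a b : Vertex} (h : IsInnerInterval P a b) :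
    intervalMinor K a b ∈ ambientIdeal K P :=
  Ideal.subset_span ⟨a, b, h, rfl⟩

theorem restrict_X_of_mem {V : Finset Vertex} {v : Vertex} (h : v ∈ V) :
    restrict K V (X v) = X ⟨v, h⟩ := by
  simp [restrict, h]

theorem restrict_X_of_notMem {V : Finset Vertex} {v : Vertex} (h : v ∉ V) :
    restrict K V (X v) = 0 := by
  simp [restrict, h]

theorem restrict_rename {V : Finset Vertex} (f : MvPolynomial V K) :
    restrict K V (rename Subtype.val f) = f := by
  have : (restrict K V).comp (rename Subtype.val) = AlgHom.id K _ := by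
    ext v
    simp [restrict_X_of_mem v.2]
  exact DFunLike.congr_fun this f

theorem restrict_intervalMinor_mem {P : Finset Cell} {a b : Vertex} (h : IsInnerInterval P a b) :
    restrict K (vertexSet P) (intervalMinor K a b) ∈ polyominoIdeal K P := by
  have ha : a ∈ vertexSet P := h.mem_vertexSet (Or.inl rfl) (Or.inl rfl)
  have hb : b ∈ vertexSet P := h.mem_vertexSet (Or.inr rfl) (Or.inr rfl)
  have hc : (a.1, b.2) ∈ vertexSet P := h.mem_vertexSet (Or.inl rfl) (Or.inr rfl)
  have hd : (b.1, a.2) ∈ vertexSet P := h.mem_vertexSet (Or.inr rfl) (Or.inl rfl)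
  rw [intervalMinor, map_sub, map_mul, map_mul, restrict_X_of_mem ha, restrict_X_of_mem hb,
    restrict_X_of_mem hc, restrict_X_of_mem hd]
  exact Ideal.subset_span ⟨⟨a, ha⟩, ⟨b, hb⟩, ⟨_, hc⟩, ⟨_, hd⟩, h, rfl, rfl, rfl⟩

theorem restrict_mem {P : Finset Cell} {f : MvPolynomial Vertex K} (hf : f ∈ ambientIdeal K P) :
    restrict K (vertexSet P) f ∈ polyominoIdeal K P := by
  have : ambientIdeal K P ≤ (polyominoIdeal K P).comap (restrict K (vertexSet P)) :=
    Ideal.span_le.2 fun f hf => by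
      obtain ⟨a, b, h, rfl⟩ := hf
      exact restrict_intervalMinor_mem h
  exact this hf

/-- `restrict` is a retraction of the inclusion of polynomial rings and both maps respect the
ideals. Hence membership for different collections can be tested in the ring on all vertices. -/
theorem rename_mem_ambientIdeal_iff {P : Finset Cell} {f : MvPolynomial (vertexSet P) K} :
    rename Subtype.val f ∈ ambientIdeal K P ↔ f ∈ polyominoIdeal K P := by
  refine ⟨fun h => restrict_rename f ▸ restrict_mem h, fun h => ?_⟩
  have : polyominoIdeal K P ≤ (ambientIdeal K P).comap
      (rename Subtype.val : MvPolynomial (vertexSet P) K →ₐ[K] _) :=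
    Ideal.span_le.2 fun f hf => by
      obtain ⟨a, b, c, d, h, hc, hd, rfl⟩ := hf
      have := intervalMinor_mem (K := K) h
      rw [intervalMinor, ← hc, ← hd] at this
      simpa using this
  exact this h

/-! ### Syzygies of the corner variables and independence of normal forms. -/

/-- The product of the diagonal variables of the interval with anti-diagonal corners `(x, y + 1)`
and `v`. -/
noncomputable def cornerProduct (K : Type*) [Field K] (x y : ℤ) (v : Vertex) :
    MvPolynomial Vertex K :=
  X (x, v.2) * X (v.1, y + 1)

theorem intervalMinor_corner (x y : ℤ) (v : Vertex) :
    intervalMinor K (x, v.2) (v.1, y + 1) = cornerProduct K x y v - X (x, y + 1) * X v :=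
  rfl

namespace IsCorner

variable {P : Finset Cell} {x y : ℤ}

/-- The fractions q_v / x_v agree modulo the minors of the two single cells `(x, y - 1)` and `(x +
1, y)`. This is the compatibility condition in `exists_linearMap_X_mul`. -/
theorem cornerProduct_mul_X_sub_mem (h : IsCorner P x y) :
    ∀ v ∈ cornerVertices x y, ∀ w ∈ cornerVertices x y,
      cornerProduct K x y v * X w - cornerProduct K x y w * X v ∈
        ambientIdeal K (P \ {(x, y)}) := by
  have key : ∀ v ∈ cornerVertices x y, ∀ w ∈ cornerVertices x y,
      ∃ r s, cornerProduct K x y v * X w - cornerProduct K x y w * X v =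
        r * intervalMinor K (x, y - 1) (x + 1, y) +
          s * intervalMinor K (x + 1, y) (x + 2, y + 1) := by
    rintro ⟨i, j⟩ hv ⟨k, l⟩ hw
    rw [mem_cornerVertices] at hv hw
    unfold cornerProduct intervalMinor
    rcases hv with ⟨rfl, rfl⟩ | ⟨rfl, rfl⟩ | ⟨rfl, rfl⟩ <;>
    rcases hw with ⟨rfl, rfl⟩ | ⟨rfl, rfl⟩ | ⟨rfl, rfl⟩
    · exact ⟨0, 0, by ring⟩
    · exact ⟨-X (x + 1, j + 1), 0, by ring⟩
    · exact ⟨0, -X (x, l), by ring⟩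
    · exact ⟨X (x + 1, l + 1), 0, by ring⟩
    · exact ⟨0, 0, by ring⟩
    · exact ⟨X (x + 2, l + 1), -X (x, l - 1), by ring⟩
    · exact ⟨0, X (x, l), by ring⟩
    · exact ⟨-X (x + 2, j + 1), X (x, j - 1), by ring⟩
    · exact ⟨0, 0, by ring⟩
  intro v hv w hw
  obtain ⟨r, s, e⟩ := key v hv w hw
  rw [e]
  exact Ideal.add_mem _ (Ideal.mul_mem_left _ _ (intervalMinor_mem h.isInnerInterval_below))
    (Ideal.mul_mem_left _ _ (intervalMinor_mem h.isInnerInterval_right))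

/-- The map `φ` imitates multiplication by the common fraction q_v / x_v. It suffices that `φ`
preserves `I`: applied to `∑ a v * X v`, it gives `∑ a v * cornerProduct v` modulo `I`. As `φ` is
only `K`-linear, all multiples of the generators have to be checked. -/
theorem sum_mul_cornerProduct_mem (h : IsCorner P x y)
    (a : cornerVertices x y → MvPolynomial Vertex K)
    (ha : ∑ v, a v * X (v : Vertex) ∈ ambientIdeal K (P \ {(x, y)})) :
    ∑ v, a v * cornerProduct K x y v ∈ ambientIdeal K (P \ {(x, y)}) := by
  set I := ambientIdeal K (P \ {(x, y)}) with hI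
  obtain ⟨φ, h₁, h₂⟩ := exists_linearMap_X_mul I (cornerProduct K x y) (cornerVertices x y)
    h.cornerProduct_mul_X_sub_mem
  have hgen : ∀ a b, IsInnerInterval (P \ {(x, y)}) a b → ∀ g, φ (g * intervalMinor K a b) ∈ I := by
    intro a b hab g
    rcases h.isInnerInterval_sdiff_cases hab with hQ | ⟨i, rfl, rfl, hi, hix⟩ |
      ⟨j, rfl, rfl, hj, hyj⟩
    -- This minor involves no corner variable, so `φ` commutes with it.
    · have hT : ∀ v : Vertex, (v.1 = a.1 ∨ v.1 = b.1) → (v.2 = a.2 ∨ v.2 = b.2) →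
          v ∉ cornerVertices x y := fun v k₁ k₂ =>
        ((h.mem_vertexSet_sdiff_iff v).1 (hQ.mem_vertexSet k₁ k₂)).2
      have e : g * intervalMinor K a b =
          X a * (X b * g) - X (a.1, b.2) * (X (b.1, a.2) * g) := by
        rw [intervalMinor]; ring
      have e' : X a * (X b * φ g) - X (a.1, b.2) * (X (b.1, a.2) * φ g) =
          φ g * intervalMinor K a b := by
        rw [intervalMinor]; ring
      rw [e, map_sub, h₂ a (hT a (by simp) (by simp)), h₂ b (hT b (by simp) (by simp)),
        h₂ _ (hT (a.1, b.2) (by simp) (by simp)), h₂ _ (hT (b.1, a.2) (by simp) (by simp)), e']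
      exact I.mul_mem_left _ (intervalMinor_mem hab)
    · have e : g * intervalMinor K (i, y - 1) (x + 1, y) =
          X (i, y - 1) * (X (x + 1, y) * g) - X (i, y) * (X (x + 1, y - 1) * g) := by
        rw [intervalMinor]; ring
      -- Each term of the strip's minor contains one corner variable; replacing it by its product
      -- yields a multiple of the minor of the shortened strip, which is zero for `i = x`.
      have hm : (X (i, y - 1) * X (x, y) - X (i, y) * X (x, y - 1) : MvPolynomial Vertex K) ∈ I := by
        rcases hi with rfl | hi
        · convert I.zero_mem using 1
          ring
        · exact intervalMinor_mem hi
      rw [e, map_sub, h₂ (i, y - 1) (by rw [mem_cornerVertices]; omega),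
        h₂ (i, y) (by rw [mem_cornerVertices]; omega)]
      have e' : X (i, y - 1) * φ (X (x + 1, y) * g) - X (i, y) * φ (X (x + 1, y - 1) * g) =
          X (i, y - 1) * (φ (X (x + 1, y) * g) - cornerProduct K x y (x + 1, y) * g) -
          X (i, y) * (φ (X (x + 1, y - 1) * g) - cornerProduct K x y (x + 1, y - 1) * g) +
          (X (x + 1, y + 1) * g) * (X (i, y - 1) * X (x, y) - X (i, y) * X (x, y - 1)) := by
        unfold cornerProduct
        ring
      rw [e']
      exact I.add_mem (I.sub_mem
        (I.mul_mem_left _ (h₁ _ (by simp [cornerVertices]) _))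
        (I.mul_mem_left _ (h₁ _ (by simp [cornerVertices]) _))) (I.mul_mem_left _ hm)
    · have e : g * intervalMinor K (x + 1, y) (x + 2, j) =
          X (x + 2, j) * (X (x + 1, y) * g) - X (x + 1, j) * (X (x + 2, y) * g) := by
        rw [intervalMinor]; ring
      have hm : (X (x + 1, y + 1) * X (x + 2, j) - X (x + 1, j) * X (x + 2, y + 1) :
          MvPolynomial Vertex K) ∈ I := by
        rcases hj with rfl | hj
        · convert I.zero_mem using 1
          ring
        · exact intervalMinor_mem hj
      rw [e, map_sub, h₂ (x + 2, j) (by rw [mem_cornerVertices]; omega),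
        h₂ (x + 1, j) (by rw [mem_cornerVertices]; omega)]
      have e' : X (x + 2, j) * φ (X (x + 1, y) * g) - X (x + 1, j) * φ (X (x + 2, y) * g) =
          X (x + 2, j) * (φ (X (x + 1, y) * g) - cornerProduct K x y (x + 1, y) * g) -
          X (x + 1, j) * (φ (X (x + 2, y) * g) - cornerProduct K x y (x + 2, y) * g) +
          (X (x, y) * g) * (X (x + 1, y + 1) * X (x + 2, j) - X (x + 1, j) * X (x + 2, y + 1)) := by
        unfold cornerProduct
        ring
      rw [e']
      exact I.add_mem (I.sub_mem
        (I.mul_mem_left _ (h₁ _ (by simp [cornerVertices]) _))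
        (I.mul_mem_left _ (h₁ _ (by simp [cornerVertices]) _))) (I.mul_mem_left _ hm)
  have hφ : ∀ f ∈ I, ∀ g, φ (g * f) ∈ I := by
    intro f hf
    rw [hI, ambientIdeal] at hf
    induction hf using Submodule.span_induction with
    | mem f hf =>
      obtain ⟨a, b, hab, rfl⟩ := hf
      exact hgen a b hab
    | zero => simp
    | add f f' _ _ hf hf' =>
      intro g
      rw [mul_add, map_add]
      exact I.add_mem (hf g) (hf' g)
    | smul r f _ hf =>
      intro g
      rw [smul_eq_mul, ← mul_assoc]
      exact hf _
  have hsum := hφ _ ha 1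
  rw [one_mul, map_sum] at hsum
  rw [← I.sub_mem_iff_right hsum, ← Finset.sum_sub_distrib]
  refine I.sum_mem fun v _ => ?_
  rw [mul_comm (a v), mul_comm (a v)]
  exact h₁ v v.2 (a v)

theorem restrict_X_corner (h : IsCorner P x y) {v : Vertex} (hv : v ∈ cornerVertices x y) :
    restrict K (vertexSet (P \ {(x, y), (x, y - 1), (x + 1, y)})) (X v) = 0 :=
  restrict_X_of_notMem fun hv' => ((h.mem_vertexSet_sdiff_iff v).1 hv').2 hv

/-- Setting the corner variables to zero kills both terms of each minor through one of the two
deleted neighbours and leaves the minors of the smaller collection. -/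
theorem restrict_mem_sdiff (h : IsCorner P x y) {f : MvPolynomial Vertex K}
    (hf : f ∈ ambientIdeal K (P \ {(x, y)}) ⊔
      Ideal.span (Set.range fun v : cornerVertices x y => X (v : Vertex))) :
    restrict K (vertexSet (P \ {(x, y), (x, y - 1), (x + 1, y)})) f ∈
      polyominoIdeal K (P \ {(x, y), (x, y - 1), (x + 1, y)}) := by
  have : ambientIdeal K (P \ {(x, y)}) ⊔
      Ideal.span (Set.range fun v : cornerVertices x y => X (v : Vertex)) ≤
        (polyominoIdeal K (P \ {(x, y), (x, y - 1), (x + 1, y)})).comap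
          (restrict K (vertexSet (P \ {(x, y), (x, y - 1), (x + 1, y)}))) := by
    refine sup_le (Ideal.span_le.2 ?_) (Ideal.span_le.2 ?_)
    · rintro _ ⟨a, b, hab, rfl⟩
      rw [SetLike.mem_coe, Ideal.mem_comap]
      rcases h.isInnerInterval_sdiff_cases hab with hQ | ⟨i, rfl, rfl, -⟩ | ⟨j, rfl, rfl, -⟩
      · exact restrict_intervalMinor_mem hQ
      · simp [intervalMinor, h.restrict_X_corner (K := K) (v := (x + 1, y)) (by simp [cornerVertices]),
          h.restrict_X_corner (K := K) (v := (x + 1, y - 1)) (by simp [cornerVertices])]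
      · simp [intervalMinor, h.restrict_X_corner (K := K) (v := (x + 1, y)) (by simp [cornerVertices]),
          h.restrict_X_corner (K := K) (v := (x + 2, y)) (by simp [cornerVertices])]
    · rintro _ ⟨v, rfl⟩
      rw [SetLike.mem_coe, Ideal.mem_comap, h.restrict_X_corner v.2]
      exact Ideal.zero_mem _
  exact this hf

theorem vertexSet_sdiff_subset (h : IsCorner P x y) :
    vertexSet (P \ {(x, y), (x, y - 1), (x + 1, y)}) ⊆ vertexSet (P \ {(x, y)}) := fun v hv =>
  ((h.mem_vertexSet_sdiff_iff v).1 hv).1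

/-- Modulo the ideal of `P`, the polynomials on the vertices of `P \ {(x, y)}` and the products of
a positive power of the variable of `(x, y + 1)` with polynomials on the remaining
vertices are as independent as they are modulo the smaller ideals. -/
theorem mem_polyominoIdeal_of_add_sum_mem (h : IsCorner P x y) {n : ℕ}
    (r : MvPolynomial (vertexSet (P \ {(x, y)})) K)
    (s : Fin n → MvPolynomial (vertexSet (P \ {(x, y), (x, y - 1), (x + 1, y)})) K)
    (hrs : rename Subtype.val r + ∑ j, rename Subtype.val (s j) * X (x, y + 1) ^ (n - j) ∈
      ambientIdeal K P) :
    r ∈ polyominoIdeal K (P \ {(x, y)}) ∧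
      ∀ j, s j ∈ polyominoIdeal K (P \ {(x, y), (x, y - 1), (x + 1, y)}) := by
  classical
  let I := ambientIdeal K (P \ {(x, y)})
  -- The variable of `(x, y + 1)` becomes the polynomial variable over the quotient by `I`, so that
  -- membership can be read off coefficientwise.
  let ψ : MvPolynomial Vertex K →ₐ[K] Polynomial (MvPolynomial Vertex K ⧸ I) :=
    aeval fun v => if v = (x, y + 1) then Polynomial.X else Polynomial.C (Ideal.Quotient.mk I (X v))
  have hψu : ψ (X (x, y + 1)) = Polynomial.X := by simp [ψ]
  have hψX : ∀ v, v ≠ (x, y + 1) → ψ (X v) = Polynomial.C (Ideal.Quotient.mk I (X v)) := by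
    intro v hv
    simp [ψ, hv]
  have hψ : ∀ V : Finset Vertex, (x, y + 1) ∉ V → ∀ f : MvPolynomial V K,
      ψ (rename Subtype.val f) = Polynomial.C (Ideal.Quotient.mk I (rename Subtype.val f)) := by
    intro V hV f
    have : ψ.comp (rename Subtype.val) = (Polynomial.CAlgHom.comp
        (Ideal.Quotient.mkₐ K I)).comp (rename (Subtype.val : V → Vertex)) := by
      ext v
      simp only [AlgHom.comp_apply, rename_X]
      rw [hψX _ fun hv => hV (hv ▸ v.2)]
      rfl
    exact DFunLike.congr_fun this f
  have hu := h.notMem_vertexSet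
  let p : cornerVertices x y → MvPolynomial Vertex K ⧸ I := fun v => Ideal.Quotient.mk I (X v)
  let q : cornerVertices x y → MvPolynomial Vertex K ⧸ I := fun v =>
    Ideal.Quotient.mk I (cornerProduct K x y v)
  have hψI : ambientIdeal K P ≤ (Ideal.span (Set.range fun v =>
      Polynomial.X * Polynomial.C (p v) - Polynomial.C (q v))).comap ψ := by
    refine Ideal.span_le.2 ?_
    rintro _ ⟨a, b, hab, rfl⟩
    rw [SetLike.mem_coe, Ideal.mem_comap]
    rcases h.isInnerInterval_cases hab with hQ | ⟨v, hv, rfl, rfl⟩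
    · have hne : ∀ v : Vertex, (v.1 = a.1 ∨ v.1 = b.1) → (v.2 = a.2 ∨ v.2 = b.2) →
          v ≠ (x, y + 1) := fun v k₁ k₂ e => hu (e ▸ hQ.mem_vertexSet k₁ k₂)
      have hm := Ideal.Quotient.eq_zero_iff_mem.2 (intervalMinor_mem (K := K) hQ)
      rw [intervalMinor, map_sub, map_mul, map_mul] at hm
      rw [intervalMinor, map_sub, map_mul, map_mul, hψX a (hne a (by simp) (by simp)),
        hψX b (hne b (by simp) (by simp)), hψX _ (hne (a.1, b.2) (by simp) (by simp)),
        hψX _ (hne (b.1, a.2) (by simp) (by simp)), ← Polynomial.C_mul, ← Polynomial.C_mul,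
        ← Polynomial.C_sub, hm, Polynomial.C_0]
      exact Ideal.zero_mem _
    · have hv' := hv
      obtain ⟨i, j⟩ := v
      rw [mem_cornerVertices] at hv'
      have n₁ : ((x, j) : Vertex) ≠ (x, y + 1) := by rw [Ne, Prod.mk.injEq]; omega
      have n₂ : ((i, y + 1) : Vertex) ≠ (x, y + 1) := by rw [Ne, Prod.mk.injEq]; omega
      have n₃ : ((i, j) : Vertex) ≠ (x, y + 1) := by rw [Ne, Prod.mk.injEq]; omega
      rw [intervalMinor_corner, cornerProduct, map_sub, map_mul, map_mul, hψu, hψX _ n₁, hψX _ n₂,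
        hψX _ n₃, ← Polynomial.C_mul, ← map_mul, ← neg_mem_iff, neg_sub]
      exact Ideal.subset_span ⟨⟨(i, j), hv⟩, rfl⟩
  have hu' : (x, y + 1) ∉ vertexSet (P \ {(x, y), (x, y - 1), (x + 1, y)}) := fun hv =>
    hu (h.vertexSet_sdiff_subset hv)
  -- The classes of polynomials on the remaining vertices: all coefficients in positive degree lie
  -- in `S`.
  let S : Submodule K (MvPolynomial Vertex K ⧸ I) := LinearMap.range
    ((Ideal.Quotient.mkₐ K I).comp (rename (Subtype.val :
      vertexSet (P \ {(x, y), (x, y - 1), (x + 1, y)}) → Vertex))).toLinearMap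
  have hmem := hψI hrs
  rw [Ideal.mem_comap, map_add, map_sum, hψ _ hu] at hmem
  simp only [map_mul, map_pow, hψu, hψ _ hu'] at hmem
  have hc : ∀ k, (Polynomial.C (Ideal.Quotient.mk I (rename Subtype.val r)) +
      ∑ j, Polynomial.C (Ideal.Quotient.mk I (rename Subtype.val (s j))) *
        Polynomial.X ^ (n - (j : ℕ))).coeff k = (if k = 0 then
          Ideal.Quotient.mk I (rename Subtype.val r) else 0) +
        ∑ j : Fin n, if k = n - (j : ℕ) then Ideal.Quotient.mk I (rename Subtype.val (s j)) else 0 := by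
    intro k
    rw [Polynomial.coeff_add, Polynomial.coeff_C, Polynomial.finsetSum_coeff]
    simp only [Polynomial.coeff_C_mul_X_pow]
  have hzero := eq_zero_of_mem_span_X_mul_sub p q ?_ S ?_ _ hmem ?_
  -- As `j < n`, the exponents `n - j` are positive and distinct: degree `0` isolates `r` and degree
  -- `n - j` isolates `s j`.
  · have hk : ∀ k, _ := fun k => (hc k).symm.trans (by rw [hzero, Polynomial.coeff_zero])
    constructor
    · have h0 := hk 0
      rw [if_pos rfl, Finset.sum_eq_zero fun j _ => if_neg (by omega), add_zero,
        Ideal.Quotient.eq_zero_iff_mem] at h0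
      exact rename_mem_ambientIdeal_iff.1 h0
    · intro j
      have hj := hk (n - j)
      rw [if_neg (by omega), zero_add, Finset.sum_eq_single j
        (fun i _ hij => if_neg (by rw [Ne, Fin.ext_iff] at hij; omega)) (by simp), if_pos rfl,
        Ideal.Quotient.eq_zero_iff_mem] at hj
      have := h.restrict_mem_sdiff (Ideal.mem_sup_left hj)
      rwa [restrict_rename] at this
  · intro a ha
    choose a' ha' using fun v => Ideal.Quotient.mk_surjective (a v)
    obtain rfl : (fun v => Ideal.Quotient.mk I (a' v)) = a := funext ha'
    simp only [p, q, ← map_mul, ← map_sum] at ha ⊢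
    rw [Ideal.Quotient.eq_zero_iff_mem] at ha ⊢
    exact h.sum_mul_cornerProduct_mem a' ha
  -- Setting the corner variables to zero fixes `f`, so an `f` in `I + (x_v)` lies in the ideal of
  -- the smaller collection, which is contained in `I`.
  · rintro _ ⟨f, rfl⟩ hf
    change Ideal.Quotient.mk I (rename Subtype.val f) = 0
    change Ideal.Quotient.mk I (rename Subtype.val f) ∈ _ at hf
    have hr : Set.range p = Ideal.Quotient.mk I ''
        (Set.range fun v : cornerVertices x y => X (v : Vertex)) := by
      rw [← Set.range_comp]
      rfl
    rw [hr, ← Ideal.map_span, Ideal.mem_quotient_iff_mem_sup, sup_comm] at hf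
    have := h.restrict_mem_sdiff hf
    rw [restrict_rename, ← rename_mem_ambientIdeal_iff] at this
    rw [Ideal.Quotient.eq_zero_iff_mem]
    refine Ideal.span_mono ?_ this
    rintro _ ⟨a, b, hab, rfl⟩
    exact ⟨a, b, hab.mono (Finset.sdiff_subset_sdiff subset_rfl (by simp)), rfl⟩
  · intro k
    rw [hc, if_neg (by omega), zero_add]
    refine S.sum_mem fun j _ => ?_
    split_ifs
    · exact ⟨s j, rfl⟩
    · exact S.zero_mem

end IsCorner

/-! ### Graded components, normal forms and the Hilbert function. -/

/-- The graded component of degree `n` of `K[P]` as a quotient of the space of forms. -/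
noncomputable def toGradedPiece (K : Type*) [Field K] (P : Finset Cell) (n : ℕ) :
    homogeneousSubmodule (vertexSet P) K n →ₗ[K] gradedPiece K P n :=
  (Ideal.Quotient.mkₐ K (polyominoIdeal K P)).toLinearMap.submoduleMap _

theorem toGradedPiece_surjective (P : Finset Cell) (n : ℕ) :
    Function.Surjective (toGradedPiece K P n) :=
  LinearMap.submoduleMap_surjective _ _

theorem toGradedPiece_eq_zero_iff {P : Finset Cell} {n : ℕ}
    (f : homogeneousSubmodule (vertexSet P) K n) :
    toGradedPiece K P n f = 0 ↔ (f : MvPolynomial (vertexSet P) K) ∈ polyominoIdeal K P := by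
  rw [← Ideal.Quotient.eq_zero_iff_mem, ← Submodule.coe_eq_zero]
  rfl

instance (P : Finset Cell) (n : ℕ) : Module.Finite K (gradedPiece K P n) :=
  Module.Finite.iff_fg.2 ((homogeneousSubmodule_fg _ _ n).map _)

/-- The forms of degree `n` on the vertices of `P`, modulo the ambient ideal. -/
noncomputable def toAmbientQuotient (K : Type*) [Field K] (P : Finset Cell) (n : ℕ) :
    homogeneousSubmodule (vertexSet P) K n →ₗ[K] MvPolynomial Vertex K ⧸ ambientIdeal K P :=
  ((Ideal.Quotient.mkₐ K (ambientIdeal K P)).comp (rename Subtype.val)).toLinearMap.domRestrict _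

theorem finrank_range_toAmbientQuotient (P : Finset Cell) (n : ℕ) :
    Module.finrank K (LinearMap.range (toAmbientQuotient K P n)) = hilbertFunction K P n := by
  rw [finrank_range_eq_of_ker_eq _ (toGradedPiece K P n),
    LinearMap.range_eq_top.2 (toGradedPiece_surjective P n), finrank_top, hilbertFunction]
  ext f
  rw [LinearMap.mem_ker, LinearMap.mem_ker, toGradedPiece_eq_zero_iff,
    ← rename_mem_ambientIdeal_iff, ← Ideal.Quotient.eq_zero_iff_mem]
  rfl

theorem exists_homogeneous_rename_eq {V : Finset Vertex} {n : ℕ} {f : MvPolynomial Vertex K}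
    (hf : f.IsHomogeneous n) (hV : ∀ m ∈ f.support, m.support ⊆ V) :
    ∃ g : homogeneousSubmodule V K n, rename Subtype.val (g : MvPolynomial V K) = f := by
  classical
  have hs : f ∈ supported K (V : Set Vertex) := by
    rw [mem_supported]
    intro v hv
    obtain ⟨m, hm, hvm⟩ := (mem_vars_iff_mem_support v).1 hv
    exact hV m hm hvm
  rw [supported_eq_range_rename] at hs
  obtain ⟨g, rfl⟩ := hs
  exact ⟨⟨g, (IsHomogeneous.rename_isHomogeneous_iff Subtype.val_injective).1 hf⟩, rfl⟩

theorem exists_homogeneous_rename_eq_monomial {V : Finset Vertex} {n : ℕ} {m : Vertex →₀ ℕ}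
    (hn : m.degree = n) (hV : m.support ⊆ V) (c : K) :
    ∃ g : homogeneousSubmodule V K n, rename Subtype.val (g : MvPolynomial V K) = monomial m c :=
  exists_homogeneous_rename_eq (isHomogeneous_monomial c hn) fun m' hm' => by
    rwa [Finset.mem_singleton.1 (support_monomial_subset hm')]

namespace IsCorner

variable {P : Finset Cell} {x y : ℤ}

/-- The forms `r + ∑ j, s j * X u ^ (n - j)` of degree `n`, where `u = (x, y + 1)`. -/
noncomputable def normalForm (K : Type*) [Field K] (P : Finset Cell) (x y : ℤ) (n : ℕ) :
    (homogeneousSubmodule (vertexSet (P \ {(x, y)})) K n ×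
      ∀ j : Fin n,
        homogeneousSubmodule (vertexSet (P \ {(x, y), (x, y - 1), (x + 1, y)})) K j) →ₗ[K]
      MvPolynomial Vertex K where
  toFun f := rename Subtype.val f.1.1 + ∑ j, rename Subtype.val (f.2 j).1 * X (x, y + 1) ^ (n - j)
  map_add' f g := by
    simp only [Prod.fst_add, Prod.snd_add, Pi.add_apply, Submodule.coe_add, map_add, add_mul,
      Finset.sum_add_distrib]
    ring
  map_smul' c f := by
    simp only [Prod.smul_fst, Prod.smul_snd, Pi.smul_apply, Submodule.coe_smul, map_smul,
      smul_mul_assoc, Finset.smul_sum, smul_add, RingHom.id_apply]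

/-- The normal forms modulo the ideal of `P`. -/
noncomputable def normalFormQuotient (K : Type*) [Field K] (P : Finset Cell) (x y : ℤ) (n : ℕ) :
    (homogeneousSubmodule (vertexSet (P \ {(x, y)})) K n ×
      ∀ j : Fin n,
        homogeneousSubmodule (vertexSet (P \ {(x, y), (x, y - 1), (x + 1, y)})) K j) →ₗ[K]
      MvPolynomial Vertex K ⧸ ambientIdeal K P :=
  (Ideal.Quotient.mkₐ K (ambientIdeal K P)).toLinearMap.comp (normalForm K P x y n)

/-- Induction on the exponent of x_u, `u = (x, y + 1)`. If a corner variable x_v also occurs, x_u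
x_v is replaced by q_v, which lowers this exponent; otherwise the cofactor of the power of x_u uses
only the remaining vertices. -/
theorem mk_monomial_mem_range (h : IsCorner P x y) {n : ℕ} (c : K) (k : ℕ) :
    ∀ m : Vertex →₀ ℕ, m.degree = n → m.support ⊆ vertexSet P → m (x, y + 1) = k →
      Ideal.Quotient.mk (ambientIdeal K P) (monomial m c) ∈
        LinearMap.range (normalFormQuotient K P x y n) := by
  classical
  induction k with
  | zero =>
    intro m hn hm hk
    obtain ⟨g, hg⟩ := exists_homogeneous_rename_eq_monomial (V := vertexSet (P \ {(x, y)})) hn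
      (fun v hv => ((h.mem_vertexSet_iff v).1 (hm hv)).resolve_left fun e =>
        Finsupp.mem_support_iff.1 hv (e ▸ hk)) c
    refine ⟨(g, 0), congrArg (Ideal.Quotient.mk (ambientIdeal K P)) ?_⟩
    simp [normalForm, hg]
  | succ k ih =>
    intro m hn hm hk
    by_cases hT : ∃ v ∈ cornerVertices x y, m v ≠ 0
    · obtain ⟨v, hv, hmv⟩ := hT
      have hI := h.isInnerInterval_of_mem_cornerVertices hv
      have hvT := hv
      obtain ⟨i, j⟩ := v
      rw [mem_cornerVertices] at hvT
      have n₁ : ((x, j) : Vertex) ≠ (x, y + 1) := by rw [Ne, Prod.mk.injEq]; omega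
      have n₂ : ((i, y + 1) : Vertex) ≠ (x, y + 1) := by rw [Ne, Prod.mk.injEq]; omega
      have n₃ : ((i, j) : Vertex) ≠ (x, y + 1) := by rw [Ne, Prod.mk.injEq]; omega
      let s : Vertex →₀ ℕ := Finsupp.single (x, y + 1) 1 + Finsupp.single (i, j) 1
      let t : Vertex →₀ ℕ := Finsupp.single (x, j) 1 + Finsupp.single (i, y + 1) 1
      have hs : s ≤ m := by
        intro w
        simp only [s, Finsupp.add_apply, Finsupp.single_apply]
        split_ifs with h₁ h₂ h₂
        · exact absurd (h₂.trans h₁.symm) n₃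
        · subst h₁; omega
        · subst h₂; omega
        · omega
      obtain ⟨m', rfl⟩ := le_iff_exists_add.1 hs
      have hdiff : monomial (s + m') c - monomial (t + m') c =
          -(monomial m' c * intervalMinor K (x, j) (i, y + 1)) := by
        have hs' : monomial (s + m') c =
            X (x, y + 1) * X (i, j) * (monomial m' c : MvPolynomial Vertex K) := by
          simp [s, X, monomial_mul]
        have ht' : monomial (t + m') c =
            X (x, j) * X (i, y + 1) * (monomial m' c : MvPolynomial Vertex K) := by
          simp [t, X, monomial_mul]
        rw [hs', ht', intervalMinor]
        ring
      rw [(Ideal.Quotient.mk_eq_mk_iff_sub_mem _ _).2 (hdiff ▸ Ideal.neg_mem_iff _ |>.2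
        (Ideal.mul_mem_left _ _ (intervalMinor_mem hI)))]
      refine ih _ ?_ ?_ ?_
      · rw [← hn]
        simp [s, t]
      · intro w hw
        rw [Finsupp.mem_support_iff, Finsupp.add_apply] at hw
        by_cases hm' : m' w = 0
        · have ht : t w ≠ 0 := by omega
          simp only [t, Finsupp.add_apply, Finsupp.single_apply] at ht
          split_ifs at ht with h₁ h₂ h₂
          · exact h₁ ▸ hI.mem_vertexSet (Or.inl rfl) (Or.inl rfl)
          · exact h₁ ▸ hI.mem_vertexSet (Or.inl rfl) (Or.inl rfl)
          · exact h₂ ▸ hI.mem_vertexSet (Or.inr rfl) (Or.inr rfl)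
          · omega
        · refine hm (Finsupp.mem_support_iff.2 ?_)
          rw [Finsupp.add_apply]
          omega
      · simp only [s, t, Finsupp.add_apply, Finsupp.single_apply, if_neg n₁, if_neg n₂, if_neg n₃,
          if_true] at hk ⊢
        omega
    · push Not at hT
      have hsplit := Finsupp.erase_add_single (x, y + 1) m
      have hdeg : (m.erase (x, y + 1)).degree = n - (k + 1) ∧ k + 1 ≤ n := by
        have := congrArg Finsupp.degree hsplit
        rw [map_add, Finsupp.degree_single, hk, hn] at this
        omega
      have hu : ∀ v, m.erase (x, y + 1) v ≠ 0 → v ≠ (x, y + 1) ∧ m v ≠ 0 := by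
        intro v hv
        by_cases e : v = (x, y + 1)
        · exact absurd (e ▸ Finsupp.erase_same) hv
        · exact ⟨e, by rwa [Finsupp.erase_ne e] at hv⟩
      -- The degree of the cofactor, so that the exponent `n - j` is `k + 1`.
      let j : Fin n := ⟨n - (k + 1), by omega⟩
      obtain ⟨g, hg⟩ := exists_homogeneous_rename_eq_monomial (n := (j : ℕ))
        (V := vertexSet (P \ {(x, y), (x, y - 1), (x + 1, y)})) hdeg.1
        (fun v hv => by
          obtain ⟨h₁, h₂⟩ := hu v (Finsupp.mem_support_iff.1 hv)
          exact (h.mem_vertexSet_sdiff_iff v).2 ⟨((h.mem_vertexSet_iff v).1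
            (hm (Finsupp.mem_support_iff.2 h₂))).resolve_left h₁, fun hvT => h₂ (hT v hvT)⟩) c
      refine ⟨(0, Pi.single j g), congrArg (Ideal.Quotient.mk (ambientIdeal K P)) ?_⟩
      have hj : n - (j : ℕ) = k + 1 := by simp only [j]; omega
      simp only [normalForm, LinearMap.coe_mk, AddHom.coe_mk]
      rw [Finset.sum_eq_single j (fun i _ hij => by simp [Pi.single_eq_of_ne hij]) (by simp),
        Pi.single_eq_same, hg, hj, X_pow_eq_monomial, monomial_mul, mul_one, ← hk, hsplit]
      simp

theorem range_normalFormQuotient (h : IsCorner P x y) (n : ℕ) :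
    LinearMap.range (normalFormQuotient K P x y n) =
      LinearMap.range (toAmbientQuotient K P n) := by
  classical
  apply le_antisymm
  · rintro _ ⟨⟨r, s⟩, rfl⟩
    have hren : ∀ V : Finset Vertex, V ⊆ vertexSet P → ∀ (f : MvPolynomial V K) (j : ℕ),
        f.IsHomogeneous j → j ≤ n → ∃ g : homogeneousSubmodule (vertexSet P) K n,
          rename Subtype.val (g : MvPolynomial (vertexSet P) K) =
            rename Subtype.val f * X (x, y + 1) ^ (n - j) := by
      intro V hV f j hf hj
      have hu : (x, y + 1) ∈ vertexSet P := (h.mem_vertexSet_iff _).2 (Or.inl rfl)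
      refine ⟨⟨rename (fun v => ⟨v.1, hV v.2⟩) f * X ⟨_, hu⟩ ^ (n - j), ?_⟩, ?_⟩
      · have := (hf.rename_isHomogeneous (f := fun v : V => (⟨v.1, hV v.2⟩ : vertexSet P))).mul
          ((isHomogeneous_X K (⟨_, hu⟩ : vertexSet P)).pow (n - j))
        rw [mem_homogeneousSubmodule]
        convert this using 1
        omega
      · simp [rename_rename, Function.comp_def]
    have hQ : vertexSet (P \ {(x, y)}) ⊆ vertexSet P := fun v hv =>
      (h.mem_vertexSet_iff v).2 (Or.inr hv)
    obtain ⟨g, hg⟩ := hren _ hQ r.1 n r.2 le_rfl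
    choose g' hg' using fun j : Fin n =>
      hren _ (h.vertexSet_sdiff_subset.trans hQ) (s j).1 j (s j).2 j.2.le
    refine ⟨g + ∑ j, g' j, congrArg (Ideal.Quotient.mk (ambientIdeal K P)) ?_⟩
    change rename Subtype.val (g + ∑ j, g' j : homogeneousSubmodule (vertexSet P) K n).1 = _
    simp [normalForm, hg, hg']
  · rintro _ ⟨f, rfl⟩
    change Ideal.Quotient.mk (ambientIdeal K P) (rename Subtype.val f.1) ∈ _
    have hf : (rename Subtype.val f.1 : MvPolynomial Vertex K).IsHomogeneous n :=
      f.2.rename_isHomogeneous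
    have hV : ∀ m ∈ (rename Subtype.val f.1 : MvPolynomial Vertex K).support,
        m.support ⊆ vertexSet P := by
      intro m hm v hv
      have : rename Subtype.val f.1 ∈ supported K (vertexSet P : Set Vertex) := by
        rw [supported_eq_range_rename]
        exact ⟨f.1, rfl⟩
      exact mem_supported.1 this ((mem_vars_iff_mem_support v).2 ⟨m, hm, hv⟩)
    rw [as_sum (rename Subtype.val f.1), map_sum]
    refine Submodule.sum_mem _ fun m hm => ?_
    refine h.mk_monomial_mem_range _ _ m ?_ (hV m hm) rfl
    by_contra hne
    exact mem_support_iff.1 hm (hf.coeff_eq_zero hne)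

/-- The normal forms of degree `n` fill the degree `n` part of K[P], and those that vanish there are
exactly the ones whose components vanish in their own coordinate rings. So the space is isomorphic
to the product of the graded pieces on the right. -/
theorem hilbertFunction_eq (h : IsCorner P x y) (n : ℕ) :
    hilbertFunction K P n = hilbertFunction K (P \ {(x, y)}) n +
      ∑ j ∈ Finset.range n,
        hilbertFunction K (P \ {(x, y), (x, y - 1), (x + 1, y)}) j := by
  let G := (toGradedPiece K (P \ {(x, y)}) n).prodMap (LinearMap.piMap fun j : Fin n =>
    toGradedPiece K (P \ {(x, y), (x, y - 1), (x + 1, y)}) j)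
  have hG : Function.Surjective G := (toGradedPiece_surjective _ n).prodMap
    (Function.Surjective.piMap fun j => toGradedPiece_surjective _ _)
  have hker : LinearMap.ker (normalFormQuotient K P x y n) = LinearMap.ker G := by
    ext ⟨r, s⟩
    have e₁ : (r, s) ∈ LinearMap.ker (normalFormQuotient K P x y n) ↔
        normalForm K P x y n (r, s) ∈ ambientIdeal K P := by
      rw [← Ideal.Quotient.eq_zero_iff_mem]
      rfl
    have e₂ : (r, s) ∈ LinearMap.ker G ↔ r.1 ∈ polyominoIdeal K (P \ {(x, y)}) ∧
        ∀ j, (s j).1 ∈ polyominoIdeal K (P \ {(x, y), (x, y - 1), (x + 1, y)}) := by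
      rw [← toGradedPiece_eq_zero_iff]
      simp only [← toGradedPiece_eq_zero_iff]
      rw [LinearMap.mem_ker, Prod.ext_iff, funext_iff]
      rfl
    rw [e₁, e₂]
    refine ⟨h.mem_polyominoIdeal_of_add_sum_mem r.1 fun j => (s j).1, fun hrs => ?_⟩
    have hmono : ∀ T : Finset Cell, ambientIdeal K (P \ T) ≤ ambientIdeal K P := by
      intro T
      refine Ideal.span_mono ?_
      rintro _ ⟨a, b, hab, rfl⟩
      exact ⟨a, b, hab.mono Finset.sdiff_subset, rfl⟩
    exact Ideal.add_mem _ (hmono _ (rename_mem_ambientIdeal_iff.2 hrs.1))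
      (Ideal.sum_mem _ fun j _ => Ideal.mul_mem_right _ _
        (hmono _ (rename_mem_ambientIdeal_iff.2 (hrs.2 j))))
  rw [← finrank_range_toAmbientQuotient P n, ← h.range_normalFormQuotient n,
    finrank_range_eq_of_ker_eq _ _ hker, LinearMap.range_eq_top.2 hG, finrank_top,
    Module.finrank_prod, Module.finrank_pi_fintype, Finset.sum_range]
  rfl

end IsCorner

end Polyomino

theorem mainTheorem9 {K : Type*} [Field K] (P : Finset Polyomino.Cell)
    (hP : Polyomino.IsClosedPath P) (A As A₁ B₁ Br : Polyomino.Cell)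
    (hW : Polyomino.IsConfigurationW P A As A₁ B₁ Br) :
    Polyomino.hilbertSeries K P =
      Polyomino.hilbertSeries K (P \ {A}) +
        (PowerSeries.X * (1 - PowerSeries.X)⁻¹) *
          Polyomino.hilbertSeries K (P \ {A, A₁, B₁}) := by
  obtain ⟨h, rfl, rfl⟩ := hW.isCorner hP
  ext n
  rw [map_add, Polyomino.coeff_X_mul_inv_one_sub_X_mul]
  simp only [Polyomino.hilbertSeries, PowerSeries.coeff_mk]
  exact_mod_cast h.hilbertFunction_eq n
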